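/- A snake graph $\mathcal{G}$ is a plane graph formed by gluing finitely many (at least one) unit squares, called tiles, in sequence, each one either directly to the right of or directly above the previous one; its vertices and edges are the vertices and sides of the tiles. Let $\mathcal{G} = (V,E)$ be a snake graph, with a proper black/white coloring of its vertices, and let $\mathbf{n} \colon V \to \mathbb{N}$ be any labeling of the vertices by non-negative integers. A mixed dimer cover (or $\mathbf{n}$-dimer cover) of $\mathcal{G}$ is a function $\mathbf{m} \colon E \to \mathbb{N}$ such that $\sum_{e \ni v} \mathbf{m}(e) = \mathbf{n}(v)$ for every $v \in V$, and $\Omega_{\mathbf{n}}(\mathcal{G})$ denotes the set of all of them. Going counterclockwise around a tile, call the edges traversed from black to white even and those traversed from white to black odd. If the multiplicities of all odd edges of a tile are positive, a positive face twist at this tile decreases the multiplicities of its odd edges by $1$ and increases those of its even edges by $1$. For $\omega,\omega' \in \Omega_{\mathbf{n}}(\mathcal{G})$ write $\omega \le \omega'$ (the face-twist order) if $\omega'$ can be obtained from $\omega$ by a finite (possibly empty) sequence of positive face twists. Theorem. The relation $\le$ is a partial order on $\Omega_{\mathbf{n}}(\mathcal{G})$ whose covering relations are exactly the positive face twists, and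 under this order $\Omega_{\mathbf{n}}(\mathcal{G})$ is a distributive lattice (with the convention that the empty poset counts as one, in case $\mathcal{G}$ has no $\mathbf{n}$-dimer cover). -/

import Mathlib

/-! ### Mixed dimer covers and face twists of a bipartite plane graph -/

/-- A mixed dimer cover (`n`-dimer cover) of a finite graph `G` with vertex labels `n`: a function
assigning a non-negative integer multiplicity to each edge of `G` such that, for each vertex `v`,
the multiplicities of the edges incident to `v` sum to `n v`. -/
@[ext]
structure MixedDimerCover {V : Type} [DecidableEq V] (G : SimpleGraph V) [Fintype G.edgeSet]
    (n : V → ℕ) where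
  /-- the multiplicity of each edge -/
  mult : G.edgeSet → ℕ
  /-- each vertex has the prescribed degree -/
  degree_eq : ∀ v : V, ∑ e ∈ Finset.univ.filter (fun e : G.edgeSet => v ∈ (e : Sym2 V)), mult e = n v

namespace FaceTwist

variable {V : Type} {G : SimpleGraph V}

/-- Given a black/white coloring (`true` is black, `false` is white) and the set `F` of the directed
edges met when going around a face counterclockwise, the even edges of the face are those
traversed from black to white. -/
def evenEdges (C : G.Coloring Bool) (F : Set G.Dart) : Set G.edgeSet :=
  {e | ∃ d ∈ F, C d.fst = true ∧ d.edge = e}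

/-- The odd edges of a face are those traversed (counterclockwise) from white to black. -/
def oddEdges (C : G.Coloring Bool) (F : Set G.Dart) : Set G.edgeSet :=
  {e | ∃ d ∈ F, C d.fst = false ∧ d.edge = e}

/-- `b` is obtained from `a` by a positive face twist at the face with counterclockwise
boundary `F`: the multiplicities of the odd edges of the face (which have to be positive) decrease
by one, those of the even edges increase by one, and all others are unchanged. -/
def IsPositiveTwistAt [DecidableEq V] [Fintype G.edgeSet] {n : V → ℕ}
    (C : G.Coloring Bool) (F : Set G.Dart) (a b : MixedDimerCover G n) : Prop :=
  (∀ e ∈ oddEdges C F, 0 < a.mult e ∧ b.mult e = a.mult e - 1) ∧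
  (∀ e ∈ evenEdges C F, b.mult e = a.mult e + 1) ∧
  (∀ e, e ∉ oddEdges C F → e ∉ evenEdges C F → b.mult e = a.mult e)

end FaceTwist

/-! ### Snake graphs -/

/-- The two ways of gluing the next tile of a snake graph: to the right of the previous tile, or
above it. -/
inductive SnakeStep where
  | R : SnakeStep
  | U : SnakeStep
deriving DecidableEq

namespace Snake

/-- The lower left vertex of the tile number `i` (counting from `0`) of the snake graph with
word `w`, drawn in the plane with unit square tiles, the first one with lower left vertex `(0, 0)`.
A snake graph with word `w` has `w.length + 1` tiles. -/
def tilePos (w : List SnakeStep) (i : Fin (w.length + 1)) : ℕ × ℕ :=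
  ((w.take i).count SnakeStep.R, (w.take i).count SnakeStep.U)

/-- The four vertices of tile number `i`, in counterclockwise order, from the lower left one. -/
def corner (w : List SnakeStep) (i : Fin (w.length + 1)) : Fin 4 → ℕ × ℕ :=
  ![((tilePos w i).1, (tilePos w i).2),
    ((tilePos w i).1 + 1, (tilePos w i).2),
    ((tilePos w i).1 + 1, (tilePos w i).2 + 1),
    ((tilePos w i).1, (tilePos w i).2 + 1)]

/-- The vertices of the snake graph with word `w`: the vertices of its tiles. -/
def vertices (w : List SnakeStep) : Finset (ℕ × ℕ) :=
  Finset.univ.image fun ik : Fin (w.length + 1) × Fin 4 => corner w ik.1 ik.2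

/-- The type of vertices of the snake graph with word `w`. -/
abbrev Vertex (w : List SnakeStep) : Type := {p : ℕ × ℕ // p ∈ vertices w}

/-- A corner of a tile, as a vertex of the snake graph. -/
def vertex (w : List SnakeStep) (i : Fin (w.length + 1)) (k : Fin 4) : Vertex w :=
  ⟨corner w i k, Finset.mem_image.mpr ⟨(i, k), Finset.mem_univ _, rfl⟩⟩

theorem vertex_ne (w : List SnakeStep) (i : Fin (w.length + 1)) (k : Fin 4) :
    vertex w i k ≠ vertex w i (k + 1) := by
  intro h
  have h' : corner w i k = corner w i (k + 1) := congrArg Subtype.val h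
  fin_cases k <;> simp [corner, Prod.ext_iff] at h'

/-- The snake graph with word `w`: the edges are the sides of the tiles. -/
def graph (w : List SnakeStep) : SimpleGraph (Vertex w) where
  Adj p q := ∃ (i : Fin (w.length + 1)) (k : Fin 4),
    (p = vertex w i k ∧ q = vertex w i (k + 1)) ∨ (q = vertex w i k ∧ p = vertex w i (k + 1))
  symm := ⟨fun _ _ ⟨i, k, h⟩ => ⟨i, k, h.symm⟩⟩
  loopless := ⟨by
    rintro p ⟨i, k, ⟨h₁, h₂⟩ | ⟨h₁, h₂⟩⟩ <;> exact vertex_ne w i k (h₁.symm.trans h₂)⟩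

instance (w : List SnakeStep) : DecidableRel (graph w).Adj := fun p q =>
  inferInstanceAs (Decidable (∃ (i : Fin (w.length + 1)) (k : Fin 4),
    (p = vertex w i k ∧ q = vertex w i (k + 1)) ∨ (q = vertex w i k ∧ p = vertex w i (k + 1))))

/-- The side number `k` of tile number `i`, directed counterclockwise around the tile. -/
def tileDart (w : List SnakeStep) (i : Fin (w.length + 1)) (k : Fin 4) : (graph w).Dart :=
  ⟨(vertex w i k, vertex w i (k + 1)), ⟨i, k, Or.inl ⟨rfl, rfl⟩⟩⟩

/-- The counterclockwise boundary of tile number `i`. The tiles are the bounded faces of the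
snake graph. -/
def tileBoundary (w : List SnakeStep) (i : Fin (w.length + 1)) : Set (graph w).Dart :=
  Set.range (tileDart w i)

/-- The set `Ω_n(G)` of mixed dimer covers of the snake graph `G` with word `w` and vertex
labels `n`. -/
abbrev Covers (w : List SnakeStep) (n : Vertex w → ℕ) : Type := MixedDimerCover (graph w) n

/-- `b` is obtained from `a` by a positive face twist at some tile. -/
def PositiveFaceTwist {w : List SnakeStep} {n : Vertex w → ℕ} (C : (graph w).Coloring Bool)
    (a b : Covers w n) : Prop :=
  ∃ i, FaceTwist.IsPositiveTwistAt C (tileBoundary w i) a b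

/-- The face-twist order: `b` can be reached from `a` by finitely many (possibly no) positive face
twists. -/
def FaceTwistLE {w : List SnakeStep} {n : Vertex w → ℕ} (C : (graph w).Coloring Bool) :
    Covers w n → Covers w n → Prop :=
  Relation.ReflTransGen (PositiveFaceTwist C)

end Snake

/-!
The difference of two mixed dimer covers is an integral edge function whose sum at each vertex is
`0`. The signed boundaries of the tiles (`1` on even edges, `-1` on odd edges) form a basis of the
group of these functions (`Snake.exists_eq_sum_boundary`, `Snake.eq_zero_of_sum_boundary_eq_zero`),
so that, up to a common translation, the covers are described by integer heights of the tiles, and a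
positive face twist raises one height by `1`.

A vector of heights comes from a cover exactly if all the resulting multiplicities are nonnegative.
An edge is even for at most one tile and odd for at most one tile (`Snake.boundary_unique`), so each
such condition has the form `x i - x j ≥ c`, `x i ≥ c` or `-x i ≥ c`. These conditions are preserved
by pointwise maxima and minima; hence the covers form a sublattice of `ℤ ^ tiles`, a distributive
lattice under the pointwise order of heights.

This order is generated by twists: if `a < b`, let `d` be the difference of heights. Among the tiles
where `d` is maximal there is one at which `a` can be twisted. Indeed, an odd edge of such a tile with
multiplicity `0` in `a` must be even for another tile where `d` is maximal, and the passage from a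
tile to its neighbour in this way cannot continue forever, as the tiles form a path and neighbours
share only one edge (`Snake.exists_rank`). As a twist raises the sum of the heights by `1`, twists
are the covering relations. This part of the argument, `MixedDimerCover.exists_distribLattice`, works
for any graph with a suitable basis of signed face boundaries.
-/

/-! ### Distributive lattices from integer height functions -/

/-- A set that embeds into `ℤ^ι` with image closed under joins and meets is a distributive lattice.
If each strict inequality can be started by a unit step `T`, this order is generated by the unit steps,
and they are its covering relations. -/
theorem exists_distribLattice_of_height {X ι : Type*} [Fintype ι] [DecidableEq ι]
    (h : X → ι → ℤ) (h_inj : Function.Injective h)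
    (h_sup : ∀ a b, ∃ c, h c = h a ⊔ h b) (h_inf : ∀ a b, ∃ c, h c = h a ⊓ h b)
    (T : X → X → Prop) (hT : ∀ a b, T a b ↔ ∃ i, h b = h a + Pi.single i 1)
    (h_step : ∀ a b, h a < h b → ∃ c, T a c ∧ h c ≤ h b) :
    ∃ _ : DistribLattice X,
      (∀ a b : X, a ≤ b ↔ Relation.ReflTransGen T a b) ∧ (∀ a b : X, a ⋖ b ↔ T a b) := by
  classical
  choose sup hsup using h_sup
  choose inf hinf using h_inf
  let _ : Max X := ⟨sup⟩
  let _ : Min X := ⟨inf⟩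
  let _ : LE X := ⟨fun a b => h a ≤ h b⟩
  let _ : LT X := ⟨fun a b => h a < h b⟩
  let L : DistribLattice X :=
    h_inj.distribLattice h Iff.rfl Iff.rfl hsup hinf
  have le_def : ∀ a b : X, a ≤ b ↔ h a ≤ h b := fun _ _ => Iff.rfl
  have lt_def : ∀ a b : X, a < b ↔ h a < h b := fun _ _ => Iff.rfl
  have T_lt : ∀ a b, T a b → h a < h b := by
    intro a b hab
    obtain ⟨i, hi⟩ := (hT a b).1 hab
    rw [hi]
    exact lt_add_of_pos_right _ (Pi.single_pos.2 one_pos)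
  have sum_lt : ∀ a b, h a < h b → ∑ i, h a i < ∑ i, h b i := fun a b hab => by
    obtain ⟨hle, i, hi⟩ := Pi.lt_def.1 hab
    exact Finset.sum_lt_sum (fun j _ => hle j) ⟨i, Finset.mem_univ i, hi⟩
  refine ⟨L, fun a b => ⟨fun hab => ?_, fun hab => ?_⟩, fun a b => ⟨fun hab => ?_, fun hab => ?_⟩⟩
  · rw [le_def] at hab
    obtain ⟨m, hm⟩ : ∃ m : ℕ, ∑ i, h b i - ∑ i, h a i ≤ m := ⟨_, Int.self_le_toNat _⟩
    induction m generalizing a with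
    | zero =>
      rcases hab.eq_or_lt with heq | hlt
      · rw [h_inj heq]
      · have := sum_lt a b hlt
        push_cast at hm
        omega
    | succ m ih =>
      rcases hab.eq_or_lt with heq | hlt
      · rw [h_inj heq]
      · obtain ⟨c, hac, hcb⟩ := h_step a b hlt
        have := sum_lt a c (T_lt a c hac)
        push_cast at hm
        exact Relation.ReflTransGen.head hac (ih c hcb (by omega))
  · induction hab with
    | refl => exact le_rfl
    | tail _ hbc ih => exact ih.trans ((le_def _ _).2 (T_lt _ _ hbc).le)
  · obtain ⟨c, hac, hcb⟩ := h_step a b ((lt_def a b).1 hab.lt)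
    rcases hab.eq_or_eq ((le_def a c).2 (T_lt a c hac).le) ((le_def c b).2 hcb) with hc | hc
    · subst hc
      exact absurd (T_lt c c hac) (lt_irrefl _)
    · rwa [← hc]
  · refine ⟨(lt_def a b).2 (T_lt a b hab), fun c hac hcb => ?_⟩
    have h1 := sum_lt a c ((lt_def a c).1 hac)
    have h2 := sum_lt c b ((lt_def c b).1 hcb)
    obtain ⟨i, hi⟩ := (hT a b).1 hab
    simp only [hi, Pi.add_apply, Finset.sum_add_distrib, Finset.sum_pi_single', Finset.mem_univ,
      if_true] at h2
    simp at h2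
    omega

/-! ### Mixed dimer covers of a graph with a basis of signed face boundaries -/

namespace MixedDimerCover

variable {V : Type} [DecidableEq V] {G : SimpleGraph V} [Fintype G.edgeSet] {n : V → ℕ}

theorem exists_mult_eq (a : MixedDimerCover G n) (f : G.edgeSet → ℤ)
    (hf : ∀ v, ∑ e ∈ Finset.univ.filter (fun e : G.edgeSet => v ∈ (e : Sym2 V)), f e = 0)
    (h_nonneg : ∀ e, 0 ≤ a.mult e + f e) :
    ∃ c : MixedDimerCover G n, ∀ e, (c.mult e : ℤ) = a.mult e + f e := by
  refine ⟨⟨fun e => (a.mult e + f e).toNat, fun v => ?_⟩, fun e => Int.toNat_of_nonneg (h_nonneg e)⟩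
  have h1 := a.degree_eq v
  zify at h1 ⊢
  simp only [Int.ofNat_toNat, max_eq_left (h_nonneg _), Finset.sum_add_distrib, hf, h1, add_zero]

/-- The face-twist lattice for an arbitrary graph and a family `bd` of `{0, 1, -1}`-valued functions
on its edges ("signed face boundaries") which is a basis of the space of integral edge functions with
vertex sums `0`. Each edge lies in at most one boundary with sign `1`, namely that of `pos e`, and
in at most one with sign `-1`, namely that of `neg e`. The hypothesis `h_rank` says that the
relation `neg e → pos e` between faces is acyclic. -/
theorem exists_distribLattice {ι : Type*} [Fintype ι] [DecidableEq ι]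
    (bd : ι → G.edgeSet → ℤ) (pos neg : G.edgeSet → Option ι) (rank : ι → ℤ)
    (h_bd : ∀ i e, bd i e = (if pos e = some i then 1 else 0) - (if neg e = some i then 1 else 0))
    (h_rank : ∀ e i j, neg e = some i → pos e = some j → rank i < rank j)
    (h_cycle : ∀ i v,
      ∑ e ∈ Finset.univ.filter (fun e : G.edgeSet => v ∈ (e : Sym2 V)), bd i e = 0)
    (h_span : ∀ f : G.edgeSet → ℤ,
      (∀ v, ∑ e ∈ Finset.univ.filter (fun e : G.edgeSet => v ∈ (e : Sym2 V)), f e = 0) →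
        ∃ h : ι → ℤ, ∀ e, f e = ∑ i, h i * bd i e)
    (h_indep : ∀ h : ι → ℤ, (∀ e, ∑ i, h i * bd i e = 0) → h = 0)
    (T : MixedDimerCover G n → MixedDimerCover G n → Prop)
    (hT : ∀ a b, T a b ↔ ∃ i, ∀ e, (b.mult e : ℤ) = a.mult e + bd i e) :
    ∃ _ : DistribLattice (MixedDimerCover G n),
      (∀ a b : MixedDimerCover G n, a ≤ b ↔ Relation.ReflTransGen T a b) ∧
      (∀ a b : MixedDimerCover G n, a ⋖ b ↔ T a b) := by
  obtain ⟨h, hh⟩ : ∃ h : MixedDimerCover G n → ι → ℤ, ∀ a b e,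
      (b.mult e : ℤ) = a.mult e + ∑ i, (h b i - h a i) * bd i e := by
    rcases isEmpty_or_nonempty (MixedDimerCover G n) with hE | ⟨⟨o⟩⟩
    · exact ⟨fun a => hE.elim a, fun a => hE.elim a⟩
    · have : ∀ a : MixedDimerCover G n, ∃ h : ι → ℤ, ∀ e,
          (a.mult e : ℤ) - o.mult e = ∑ i, h i * bd i e := by
        intro a
        refine h_span _ fun v => ?_
        have h1 := a.degree_eq v
        have h2 := o.degree_eq v
        zify at h1 h2
        rw [Finset.sum_sub_distrib, h1, h2, sub_self]
      choose h hh using this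
      refine ⟨h, fun a b e => ?_⟩
      simp only [sub_mul, Finset.sum_sub_distrib, ← hh]
      ring
  -- A coordinate of a combination of boundaries is a difference of at most two coefficients.
  have expand : ∀ (x : ι → ℤ) e, ∑ i, x i * bd i e = (pos e).elim 0 x - (neg e).elim 0 x := by
    intro x e
    simp only [h_bd, mul_sub, Finset.sum_sub_distrib]
    congr 1
    · cases pos e <;> simp
    · cases neg e <;> simp
  have h_of_mult : ∀ (a c : MixedDimerCover G n) (x : ι → ℤ),
      (∀ e, (c.mult e : ℤ) = a.mult e + ∑ i, x i * bd i e) → h c = h a + x := by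
    intro a c x hx
    have := h_indep (h c - h a - x) fun e => by
      simp only [Pi.sub_apply, sub_mul, Finset.sum_sub_distrib]
      have := hh a c e
      rw [hx e] at this
      simp only [sub_mul, Finset.sum_sub_distrib] at this
      linarith
    rw [sub_sub, sub_eq_zero] at this
    exact this
  have exists_height : ∀ (a : MixedDimerCover G n) (x : ι → ℤ),
      (∀ e, 0 ≤ a.mult e + ∑ i, (x i - h a i) * bd i e) → ∃ c, h c = x := by
    intro a x hx
    obtain ⟨c, hc⟩ := a.exists_mult_eq (fun e => ∑ i, (x i - h a i) * bd i e) (fun v => by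
      rw [Finset.sum_comm]
      simp only [← Finset.mul_sum, h_cycle, mul_zero, Finset.sum_const_zero]) hx
    exact ⟨c, by rw [h_of_mult a c (x - h a) hc, add_sub_cancel]⟩
  have twist_iff : ∀ a b, T a b ↔ ∃ i, h b = h a + Pi.single i 1 := by
    intro a b
    rw [hT]
    refine exists_congr fun i => ⟨fun H => h_of_mult a b _ fun e => ?_, fun H e => ?_⟩
    · rw [H e]
      simp [Pi.single_apply]
    · rw [hh a b e, H]
      simp [Pi.single_apply]
  refine exists_distribLattice_of_height h ?_ ?_ ?_ T twist_iff ?_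
  · intro a b hab
    ext e
    have := hh a b e
    simp only [hab, sub_self, zero_mul, Finset.sum_const_zero, add_zero] at this
    exact_mod_cast this.symm
  -- Nonnegativity at an edge bounds one height, or a difference of two heights: such conditions
  -- are preserved by joins and meets.
  · intro a b
    refine exists_height a _ fun e => ?_
    have hb := hh a b e
    have hb0 : (0 : ℤ) ≤ b.mult e := Int.natCast_nonneg _
    have ha0 : (0 : ℤ) ≤ a.mult e := Int.natCast_nonneg _
    rw [expand (fun i => h b i - h a i)] at hb
    rw [expand (fun i => (h a ⊔ h b) i - h a i)]
    cases hp : pos e <;> cases hq : neg e <;>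
      simp only [hp, hq, Option.elim_none, Option.elim_some, Pi.sup_apply] at hb ⊢ <;> omega
  · intro a b
    refine exists_height a _ fun e => ?_
    have hb := hh a b e
    have hb0 : (0 : ℤ) ≤ b.mult e := Int.natCast_nonneg _
    have ha0 : (0 : ℤ) ≤ a.mult e := Int.natCast_nonneg _
    rw [expand (fun i => h b i - h a i)] at hb
    rw [expand (fun i => (h a ⊓ h b) i - h a i)]
    cases hp : pos e <;> cases hq : neg e <;>
      simp only [hp, hq, Option.elim_none, Option.elim_some, Pi.inf_apply] at hb ⊢ <;> omega
  · intro a b hab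
    obtain ⟨hle, i₀, hi₀⟩ := Pi.lt_def.1 hab
    -- Twist at a face where `h b - h a` is maximal, with the largest rank among those: if an odd
    -- edge `e` of it had multiplicity `0` in `a`, then `pos e` would be a face with the same
    -- difference and a larger rank.
    obtain ⟨i, -, hi⟩ := Finset.exists_max_image Finset.univ
      (fun i => toLex (h b i - h a i, rank i)) ⟨i₀, Finset.mem_univ _⟩
    have hmax : ∀ j, h b j - h a j < h b i - h a i ∨
        h b j - h a j = h b i - h a i ∧ rank j ≤ rank i := fun j =>
      Prod.Lex.toLex_le_toLex.1 (hi j (Finset.mem_univ j))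
    have hpos : 0 < h b i - h a i := by
      rcases hmax i₀ with h1 | h1 <;> omega
    obtain ⟨c, hc⟩ := exists_height a (h a + Pi.single i 1) fun e => by
      have hb := hh a b e
      have hb0 : (0 : ℤ) ≤ b.mult e := Int.natCast_nonneg _
      have ha0 : (0 : ℤ) ≤ a.mult e := Int.natCast_nonneg _
      rw [expand (fun i => h b i - h a i)] at hb
      simp only [Pi.add_apply, add_sub_cancel_left, Pi.single_apply, ite_mul, one_mul, zero_mul,
        Finset.sum_ite_eq', Finset.mem_univ, if_true, h_bd]
      by_cases hq : neg e = some i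
      · cases hp : pos e with
        | none =>
          simp only [hp, hq, Option.elim_none, Option.elim_some] at hb ⊢
          simp
          omega
        | some j =>
          have hr := h_rank e i j hq hp
          simp only [hp, hq, Option.elim_some] at hb ⊢
          rcases hmax j with h1 | h1 <;> split_ifs <;> omega
      · rw [if_neg hq]
        split_ifs <;> omega
    refine ⟨c, (twist_iff a c).2 ⟨i, hc⟩, Pi.le_def.2 fun j => ?_⟩
    have hj : h a j ≤ h b j := hle j
    rw [hc, Pi.add_apply, Pi.single_apply]
    split_ifs with hji
    · rw [hji]
      omega
    · rwa [add_zero]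

end MixedDimerCover

/-! ### Vertices and sides of the tiles -/

namespace Snake

variable {w : List SnakeStep}

/-- The tiles lie on successive antidiagonals; in particular the position determines the tile. -/
theorem tilePos_add (w : List SnakeStep) (i : Fin (w.length + 1)) :
    (tilePos w i).1 + (tilePos w i).2 = i := by
  have key : ∀ l : List SnakeStep, l.count SnakeStep.R + l.count SnakeStep.U = l.length := by
    intro l
    induction l with
    | nil => rfl
    | cons s l ih => cases s <;> simp [← ih] <;> omega
  rw [tilePos, key, List.length_take, min_eq_left (Nat.lt_succ_iff.1 i.2)]

theorem tilePos_mono {i j : Fin (w.length + 1)} (hij : i ≤ j) : tilePos w i ≤ tilePos w j :=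
  ⟨(List.take_sublist_take_left hij).count_le _, (List.take_sublist_take_left hij).count_le _⟩

theorem tilePos_injective : Function.Injective (tilePos w) := fun i j h => by
  have hi := tilePos_add w i
  have hj := tilePos_add w j
  rw [h] at hi
  exact Fin.ext (hi.symm.trans hj)

theorem tilePos_succ (i j : Fin (w.length + 1)) (hij : (j : ℕ) = i + 1) :
    tilePos w j = ((tilePos w i).1 + 1, (tilePos w i).2) ∨
      tilePos w j = ((tilePos w i).1, (tilePos w i).2 + 1) := by
  have hmono := tilePos_mono (w := w) (i := i) (j := j) (Fin.le_def.2 (by omega))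
  have hi := tilePos_add w i
  have hj := tilePos_add w j
  have h1 := hmono.1
  have h2 := hmono.2
  simp only [Prod.ext_iff]
  omega

theorem corner_eq (w : List SnakeStep) (i : Fin (w.length + 1)) (k : Fin 4) :
    corner w i k = ((tilePos w i).1 + (if k = 1 ∨ k = 2 then 1 else 0),
      (tilePos w i).2 + (if k = 2 ∨ k = 3 then 1 else 0)) := by
  fin_cases k <;> simp [corner]

theorem vertex_eq_iff {i j : Fin (w.length + 1)} {k l : Fin 4} :
    vertex w i k = vertex w j l ↔ corner w i k = corner w j l :=
  Subtype.ext_iff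

theorem vertex_injective (i : Fin (w.length + 1)) : Function.Injective (vertex w i) := by
  intro k l h
  rw [vertex_eq_iff, corner_eq, corner_eq, Prod.ext_iff] at h
  simp only at h
  revert h
  fin_cases k <;> fin_cases l <;> simp

/-- Side number `k` of tile number `i`, from corner `k` to corner `k + 1`, as an undirected edge. -/
def side (w : List SnakeStep) (i : Fin (w.length + 1)) (k : Fin 4) : (graph w).edgeSet :=
  ⟨(tileDart w i k).edge, (tileDart w i k).edge_mem⟩

theorem mem_side {v : Vertex w} {i : Fin (w.length + 1)} {k : Fin 4} :
    v ∈ (side w i k : Sym2 (Vertex w)) ↔ v = vertex w i k ∨ v = vertex w i (k + 1) :=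
  Sym2.mem_iff

theorem exists_eq_side (e : (graph w).edgeSet) : ∃ i k, e = side w i k := by
  obtain ⟨e, he⟩ := e
  induction e using Sym2.ind with
  | _ p q =>
    obtain ⟨i, k, ⟨rfl, rfl⟩ | ⟨rfl, rfl⟩⟩ := (SimpleGraph.mem_edgeSet _).1 he
    · exact ⟨i, k, rfl⟩
    · exact ⟨i, k, Subtype.ext Sym2.eq_swap⟩

/-- A common side of two different tiles is traversed by them in opposite directions. -/
theorem side_eq_iff {i j : Fin (w.length + 1)} {k l : Fin 4} :
    side w i k = side w j l ↔ (i = j ∧ k = l) ∨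
      (vertex w i k = vertex w j (l + 1) ∧ vertex w i (k + 1) = vertex w j l) := by
  have key : side w i k = side w j l ↔
      (vertex w i k = vertex w j l ∧ vertex w i (k + 1) = vertex w j (l + 1)) ∨
      (vertex w i k = vertex w j (l + 1) ∧ vertex w i (k + 1) = vertex w j l) :=
    Subtype.ext_iff.trans Sym2.eq_iff
  rw [key]
  refine or_congr_left ⟨fun h => ?_, fun h => by simp [h.1, h.2]⟩
  suffices h' : tilePos w i = tilePos w j ∧ k = l from ⟨tilePos_injective h'.1, h'.2⟩
  simp only [vertex_eq_iff, corner_eq, Prod.ext_iff] at h ⊢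
  revert h
  fin_cases k <;> fin_cases l <;> simp <;> omega

theorem side_injective (i : Fin (w.length + 1)) : Function.Injective (side w i) := by
  intro k l h
  rcases side_eq_iff.1 h with h | ⟨h1, h2⟩
  · exact h.2
  · have key : ∀ k l : Fin 4, k = l + 1 → k + 1 = l → k = l := by decide
    exact key k l (vertex_injective i h1) (vertex_injective i h2)

/-- A common side of two tiles joins consecutive ones, and is the right or the upper side of the
earlier one. -/
theorem side_eq_of_lt {i j : Fin (w.length + 1)} {k l : Fin 4} (hij : i < j)
    (h : side w i k = side w j l) :
    (j : ℕ) = i + 1 ∧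
      ((k = 1 ∧ tilePos w j = ((tilePos w i).1 + 1, (tilePos w i).2)) ∨
       (k = 2 ∧ tilePos w j = ((tilePos w i).1, (tilePos w i).2 + 1))) := by
  rcases side_eq_iff.1 h with h | h
  · exact absurd h.1 hij.ne
  have hi := tilePos_add w i
  have hj := tilePos_add w j
  have hij' : (i : ℕ) < j := hij
  simp only [vertex_eq_iff, corner_eq, Prod.ext_iff] at h ⊢
  revert h
  fin_cases k <;> fin_cases l <;> simp <;> omega

/-- Two tiles share at most one edge. -/
theorem side_eq_side_unique {i j : Fin (w.length + 1)} {k k' l l' : Fin 4} (hij : i < j)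
    (h : side w i k = side w j l) (h' : side w i k' = side w j l') : k = k' := by
  obtain ⟨-, h1⟩ := side_eq_of_lt hij h
  obtain ⟨-, h2⟩ := side_eq_of_lt hij h'
  rcases h1 with ⟨rfl, h1⟩ | ⟨rfl, h1⟩ <;> rcases h2 with ⟨rfl, h2⟩ | ⟨rfl, h2⟩
  · rfl
  · simp [h1] at h2
  · simp [h1] at h2
  · rfl

theorem side_right {i j : Fin (w.length + 1)}
    (h : tilePos w j = ((tilePos w i).1 + 1, (tilePos w i).2)) : side w i 1 = side w j 3 := by
  refine side_eq_iff.2 (Or.inr ?_)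
  simp [vertex_eq_iff, corner_eq, h]

theorem side_above {i j : Fin (w.length + 1)}
    (h : tilePos w j = ((tilePos w i).1, (tilePos w i).2 + 1)) : side w i 2 = side w j 0 := by
  refine side_eq_iff.2 (Or.inr ?_)
  simp [vertex_eq_iff, corner_eq, h]

/-! ### Signed boundaries of the tiles -/

/-- The sign of a side of a tile: `1` for an even side (`true` is black) and `-1` for an odd one. -/
def sideSign (C : (graph w).Coloring Bool) (i : Fin (w.length + 1)) (k : Fin 4) : ℤ :=
  if C (vertex w i k) then 1 else -1

theorem sideSign_add_one (C : (graph w).Coloring Bool) (i : Fin (w.length + 1)) (k : Fin 4) :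
    sideSign C i (k + 1) = -sideSign C i k := by
  have h := C.valid (tileDart w i k).adj
  change C (vertex w i k) ≠ C (vertex w i (k + 1)) at h
  unfold sideSign
  cases h1 : C (vertex w i k) <;> cases h2 : C (vertex w i (k + 1)) <;> simp_all

theorem sideSign_eq (C : (graph w).Coloring Bool) (i : Fin (w.length + 1)) (k : Fin 4) :
    sideSign C i k = 1 ∨ sideSign C i k = -1 := by
  unfold sideSign
  split_ifs <;> simp

theorem sideSign_of_side_eq (C : (graph w).Coloring Bool) {i j : Fin (w.length + 1)} {k l : Fin 4}
    (hij : i ≠ j) (h : side w i k = side w j l) : sideSign C i k = -sideSign C j l := by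
  rcases side_eq_iff.1 h with h | h
  · exact absurd h.1 hij
  · rw [← sideSign_add_one, sideSign, sideSign, h.1]

/-- The signed boundary of a tile: `1` on its even edges, `-1` on its odd edges, `0` elsewhere. A
positive face twist adds it to the multiplicities. -/
def boundary (C : (graph w).Coloring Bool) (i : Fin (w.length + 1)) (e : (graph w).edgeSet) : ℤ :=
  ∑ k, if e = side w i k then sideSign C i k else 0

theorem boundary_side (C : (graph w).Coloring Bool) (i : Fin (w.length + 1)) (k : Fin 4) :
    boundary C i (side w i k) = sideSign C i k := by
  simp [boundary, (side_injective i).eq_iff]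

theorem boundary_eq_zero (C : (graph w).Coloring Bool) {i : Fin (w.length + 1)}
    {e : (graph w).edgeSet} (h : ∀ k, e ≠ side w i k) : boundary C i e = 0 := by
  simp [boundary, h]

theorem boundary_eq_iff (C : (graph w).Coloring Bool) {i : Fin (w.length + 1)}
    {e : (graph w).edgeSet} {s : ℤ} (hs : s ≠ 0) :
    boundary C i e = s ↔ ∃ k, e = side w i k ∧ sideSign C i k = s := by
  constructor
  · intro h
    by_cases he : ∀ k, e ≠ side w i k
    · exact absurd ((boundary_eq_zero C he).symm.trans h).symm hs
    · push Not at he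
      obtain ⟨k, rfl⟩ := he
      exact ⟨k, rfl, boundary_side C i k ▸ h⟩
  · rintro ⟨k, rfl, h⟩
    rw [boundary_side, h]

theorem sum_boundary (C : (graph w).Coloring Bool) (i : Fin (w.length + 1)) (v : Vertex w) :
    ∑ e ∈ Finset.univ.filter (fun e : (graph w).edgeSet => v ∈ (e : Sym2 (Vertex w))),
      boundary C i e = 0 := by
  have key : ∀ k, (if v ∈ (side w i k : Sym2 (Vertex w)) then sideSign C i k else 0) =
      (if v = vertex w i k then sideSign C i k else 0) -
        (if v = vertex w i (k + 1) then sideSign C i (k + 1) else 0) := by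
    intro k
    have := vertex_ne w i k
    simp only [mem_side, sideSign_add_one]
    by_cases h1 : v = vertex w i k <;> by_cases h2 : v = vertex w i (k + 1) <;> simp_all
  simp only [boundary]
  rw [Finset.sum_comm]
  simp only [Finset.sum_ite_eq', Finset.mem_filter, Finset.mem_univ, true_and, key,
    Finset.sum_sub_distrib]
  rw [sub_eq_zero]
  -- The two sums differ by the rotation of the corners.
  exact (Equiv.sum_comp (Equiv.addRight (1 : Fin 4))
    fun k => if v = vertex w i k then sideSign C i k else 0).symm

/-- An edge is even for at most one tile, and odd for at most one tile. -/
theorem boundary_unique (C : (graph w).Coloring Bool) {i j : Fin (w.length + 1)}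
    {e : (graph w).edgeSet} {s : ℤ} (hs : s ≠ 0) (hi : boundary C i e = s)
    (hj : boundary C j e = s) : i = j := by
  obtain ⟨k, rfl, hk⟩ := (boundary_eq_iff C hs).1 hi
  obtain ⟨l, hl, hl'⟩ := (boundary_eq_iff C hs).1 hj
  by_contra hij
  have := sideSign_of_side_eq C hij hl
  omega

theorem boundary_trichotomy (C : (graph w).Coloring Bool) (i : Fin (w.length + 1))
    (e : (graph w).edgeSet) : boundary C i e = 0 ∨ boundary C i e = 1 ∨ boundary C i e = -1 := by
  by_cases he : ∀ k, e ≠ side w i k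
  · exact Or.inl (boundary_eq_zero C he)
  · push Not at he
    obtain ⟨k, rfl⟩ := he
    rw [boundary_side]
    exact Or.inr (sideSign_eq C i k)

open Classical in
/-- The tile, if any, whose signed boundary takes the value `s` at `e`. For `s = 1` and
`s = -1` there is at most one, so that the choice is immaterial. -/
noncomputable def tileOfSign (C : (graph w).Coloring Bool) (s : ℤ) (e : (graph w).edgeSet) :
    Option (Fin (w.length + 1)) :=
  if h : ∃ i, boundary C i e = s then some h.choose else none

theorem tileOfSign_eq_some_iff (C : (graph w).Coloring Bool) {s : ℤ} (hs : s ≠ 0)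
    {e : (graph w).edgeSet} {i : Fin (w.length + 1)} :
    tileOfSign C s e = some i ↔ boundary C i e = s := by
  unfold tileOfSign
  split_ifs with h
  · rw [Option.some_inj]
    refine ⟨fun H => H ▸ h.choose_spec, fun H => boundary_unique C hs h.choose_spec H⟩
  · simp only [false_iff]
    exact fun H => h ⟨i, H⟩

/-- The tiles can be ranked such that along each shared edge the rank increases from the tile for
which it is odd to the tile for which it is even. This holds because the tiles form a path, in which
neighbours share a single edge: add up `1` or `-1` along the path according to the direction. -/
theorem exists_rank (C : (graph w).Coloring Bool) : ∃ rank : Fin (w.length + 1) → ℤ,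
    ∀ e i j, boundary C i e = -1 → boundary C j e = 1 → rank i < rank j := by
  classical
  -- `up m`: the edge shared by the tiles `m` and `m + 1` is odd for `m` and even for `m + 1`.
  let up : ℕ → Prop := fun m => ∃ e, ∃ i j : Fin (w.length + 1), (i : ℕ) = m ∧ (j : ℕ) = m + 1 ∧
    boundary C i e = -1 ∧ boundary C j e = 1
  refine ⟨fun i => ∑ m ∈ Finset.range i, if up m then 1 else -1, fun e i j hi hj => ?_⟩
  obtain ⟨k, hk, hki⟩ := (boundary_eq_iff C (by norm_num)).1 hi
  obtain ⟨l, hl, hlj⟩ := (boundary_eq_iff C (by norm_num)).1 hj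
  have hne : i ≠ j := by
    rintro rfl
    omega
  rcases lt_or_gt_of_ne hne with hij | hij
  · have hs := (side_eq_of_lt hij (hk.symm.trans hl)).1
    have hup : up i := ⟨e, i, j, rfl, hs, hi, hj⟩
    simp only [hs, Finset.sum_range_succ, if_pos hup]
    omega
  · have hs := (side_eq_of_lt hij (hl.symm.trans hk)).1
    have hup : ¬ up j := by
      rintro ⟨e', i', j', hi', hj', hn, hp⟩
      obtain rfl : i' = j := Fin.ext hi'
      obtain rfl : j' = i := Fin.ext (hj'.trans hs.symm)
      obtain ⟨k', hk', hk''⟩ := (boundary_eq_iff C (by norm_num)).1 hn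
      obtain ⟨l', hl', -⟩ := (boundary_eq_iff C (by norm_num)).1 hp
      have := side_eq_side_unique hij (hl.symm.trans hk) (hk'.symm.trans hl')
      subst this
      omega
    simp only [hs, Finset.sum_range_succ, if_neg hup]
    omega

/-! ### The boundaries of the tiles form a basis -/

theorem vertex_zero_ne {i j : Fin (w.length + 1)} (hij : i < j) (m : Fin 4) :
    vertex w i 0 ≠ vertex w j m := by
  have hi := tilePos_add w i
  have hj := tilePos_add w j
  have hij' : (i : ℕ) < j := hij
  rw [Ne, vertex_eq_iff, corner_eq, corner_eq, Prod.ext_iff]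
  simp only
  split_ifs <;> simp_all <;> omega

theorem vertex_one_ne {i j : Fin (w.length + 1)} (hij : (tilePos w i).2 < (tilePos w j).2)
    (m : Fin 4) : vertex w i 1 ≠ vertex w j m := by
  rw [Ne, vertex_eq_iff, corner_eq, corner_eq, Prod.ext_iff]
  simp
  omega

theorem vertex_three_ne {i j : Fin (w.length + 1)} (hij : (tilePos w i).1 < (tilePos w j).1)
    (m : Fin 4) : vertex w i 3 ≠ vertex w j m := by
  rw [Ne, vertex_eq_iff, corner_eq, corner_eq, Prod.ext_iff]
  simp
  omega

/-- If corner `c` of tile `i` is not a corner of a later tile, then the two sides of tile `i` at this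
corner are the only edges at it that belong to a tile `j ≥ i`. Here `c + 3` is `c - 1` in `Fin 4`. -/
theorem apply_side_eq_neg {f : (graph w).edgeSet → ℤ} {i : Fin (w.length + 1)} {c : Fin 4}
    (hf : ∑ e ∈ Finset.univ.filter
      (fun e : (graph w).edgeSet => vertex w i c ∈ (e : Sym2 (Vertex w))), f e = 0)
    (hsupp : ∀ e, (∀ j, i ≤ j → ∀ k, e ≠ side w j k) → f e = 0)
    (hc : ∀ j, i < j → ∀ m, vertex w i c ≠ vertex w j m) :
    f (side w i c) = -f (side w i (c + 3)) := by
  have hcc : c + 3 + 1 = c := (by decide : ∀ c : Fin 4, c + 3 + 1 = c) c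
  have hne : side w i c ≠ side w i (c + 3) := by
    rw [Ne, (side_injective i).eq_iff]
    exact (by decide : ∀ c : Fin 4, c ≠ c + 3) c
  rw [← Finset.sum_subset (s₁ := {side w i c, side w i (c + 3)}), Finset.sum_pair hne] at hf
  · omega
  · intro e he
    simp only [Finset.mem_insert, Finset.mem_singleton] at he
    rw [Finset.mem_filter]
    rcases he with rfl | rfl
    · exact ⟨Finset.mem_univ _, mem_side.2 (Or.inl rfl)⟩
    · exact ⟨Finset.mem_univ _, mem_side.2 (Or.inr (by rw [hcc]))⟩
  · intro e he he'
    refine hsupp e fun j hj k hek => he' ?_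
    subst hek
    have hmem := mem_side.1 (Finset.mem_filter.1 he).2
    rcases hj.eq_or_lt with rfl | hlt
    · rw [(vertex_injective i).eq_iff, (vertex_injective i).eq_iff] at hmem
      rw [Finset.mem_insert, Finset.mem_singleton, (side_injective i).eq_iff,
        (side_injective i).eq_iff]
      exact (by decide : ∀ c k : Fin 4, c = k ∨ c = k + 1 → k = c ∨ k = c + 3) c k hmem
    · exact absurd hmem (not_or.2 ⟨hc j hlt k, hc j hlt (k + 1)⟩)

/-- The step of the elimination of tiles from the beginning of the snake: a function with vertex sums
`0` that lives on the tiles from `i` on and vanishes at the lower side of tile `i` lives on the tiles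
after `i`. Going around tile `i`, the value `0` passes through each corner that is not a corner of a
later tile. -/
theorem apply_eq_zero_of_apply_side_zero {f : (graph w).edgeSet → ℤ} {i : Fin (w.length + 1)}
    (hf : ∀ v, ∑ e ∈ Finset.univ.filter
      (fun e : (graph w).edgeSet => v ∈ (e : Sym2 (Vertex w))), f e = 0)
    (hsupp : ∀ e, (∀ j, i ≤ j → ∀ k, e ≠ side w j k) → f e = 0) (h0 : f (side w i 0) = 0)
    {e : (graph w).edgeSet} (he : ∀ j, i < j → ∀ k, e ≠ side w j k) : f e = 0 := by
  by_cases hei : ∀ k, e ≠ side w i k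
  · refine hsupp e fun j hj => ?_
    rcases hj.eq_or_lt with rfl | hlt
    exacts [hei, he j hlt]
  push Not at hei
  obtain ⟨k, rfl⟩ := hei
  have h3 : f (side w i 3) = 0 := by
    have := apply_side_eq_neg (hf (vertex w i 0)) hsupp fun j hj m => vertex_zero_ne hj m
    rw [h0, zero_add] at this
    omega
  have h1 : (∀ j, i < j → (tilePos w i).2 < (tilePos w j).2) → f (side w i 1) = 0 := fun H => by
    rw [apply_side_eq_neg (hf (vertex w i 1)) hsupp fun j hj m => vertex_one_ne (H j hj) m]
    simpa using h0
  have h2 : (∀ j, i < j → (tilePos w i).1 < (tilePos w j).1) → f (side w i 2) = 0 := fun H => by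
    have := apply_side_eq_neg (hf (vertex w i 3)) hsupp fun j hj m => vertex_three_ne (H j hj) m
    rw [h3, show (3 : Fin 4) + 3 = 2 from rfl] at this
    omega
  suffices (k = 1 → f (side w i 1) = 0) ∧ (k = 2 → f (side w i 2) = 0) by
    fin_cases k
    exacts [h0, this.1 rfl, this.2 rfl, h3]
  by_cases hlast : (i : ℕ) + 1 < w.length + 1
  · obtain ⟨j, hj⟩ : ∃ j : Fin (w.length + 1), (j : ℕ) = i + 1 := ⟨⟨i + 1, hlast⟩, rfl⟩
    have hij : i < j := Fin.lt_def.2 (by omega)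
    have hle : ∀ j', i < j' → tilePos w j ≤ tilePos w j' := fun j' hj' =>
      tilePos_mono (Fin.le_def.2 (by have := Fin.lt_def.1 hj'; omega))
    rcases tilePos_succ i j hj with hpos | hpos
    · refine ⟨?_, fun _ => h2 fun j' hj' => ?_⟩
      · rintro rfl
        exact absurd (side_right hpos) (he j hij 3)
      · have := (hle j' hj').1
        rw [hpos] at this
        exact this
    · refine ⟨fun _ => h1 fun j' hj' => ?_, ?_⟩
      · have := (hle j' hj').2
        rw [hpos] at this
        exact this
      · rintro rfl
        exact absurd (side_above hpos) (he j hij 0)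
  · have hno : ∀ j, ¬ i < j := fun j hj => by
      have := Fin.lt_def.1 hj
      omega
    exact ⟨fun _ => h1 fun j hj => absurd hj (hno j), fun _ => h2 fun j hj => absurd hj (hno j)⟩

/-- The signed boundaries of the tiles span the integral edge functions with vertex sums `0`:
subtracting multiples of boundaries, one clears the tiles one after the other. -/
theorem exists_eq_sum_boundary (C : (graph w).Coloring Bool) (f : (graph w).edgeSet → ℤ)
    (hf : ∀ v, ∑ e ∈ Finset.univ.filter
      (fun e : (graph w).edgeSet => v ∈ (e : Sym2 (Vertex w))), f e = 0) :
    ∃ h : Fin (w.length + 1) → ℤ, ∀ e, f e = ∑ i, h i * boundary C i e := by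
  suffices key : ∀ d m : ℕ, m + d = w.length + 1 → ∀ f : (graph w).edgeSet → ℤ,
      (∀ v, ∑ e ∈ Finset.univ.filter
        (fun e : (graph w).edgeSet => v ∈ (e : Sym2 (Vertex w))), f e = 0) →
      (∀ e, (∀ j : Fin (w.length + 1), m ≤ j → ∀ k, e ≠ side w j k) → f e = 0) →
      ∃ h : Fin (w.length + 1) → ℤ, ∀ e, f e = ∑ i, h i * boundary C i e by
    refine key (w.length + 1) 0 (zero_add _) f hf fun e he => ?_
    obtain ⟨i, k, hik⟩ := exists_eq_side e
    exact absurd hik (he i (Nat.zero_le _) k)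
  intro d
  induction d with
  | zero =>
    intro m hm f _ hsupp
    refine ⟨0, fun e => ?_⟩
    rw [hsupp e fun j hj => absurd hj (by omega)]
    simp
  | succ d ih =>
    intro m hm f hf hsupp
    let i : Fin (w.length + 1) := ⟨m, by omega⟩
    -- With this coefficient, the difference vanishes at the lower side of tile `i`.
    let x := f (side w i 0) * sideSign C i 0
    have hf' : ∀ v, ∑ e ∈ Finset.univ.filter
        (fun e : (graph w).edgeSet => v ∈ (e : Sym2 (Vertex w))), (f e - x * boundary C i e) = 0 :=
      fun v => by
        rw [Finset.sum_sub_distrib, ← Finset.mul_sum, sum_boundary, hf, mul_zero, sub_zero]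
    have h0 : f (side w i 0) - x * boundary C i (side w i 0) = 0 := by
      rw [boundary_side]
      rcases sideSign_eq C i 0 with h | h <;> simp [x, h]
    obtain ⟨h, hh⟩ := ih (m + 1) (by omega) (fun e => f e - x * boundary C i e) hf'
      fun e he => apply_eq_zero_of_apply_side_zero hf' (fun e he => by
        rw [hsupp e he, boundary_eq_zero C (he i le_rfl), mul_zero, sub_zero]) h0
        fun j hj => he j (Nat.succ_le_of_lt hj)
    refine ⟨h + Pi.single i x, fun e => ?_⟩
    have := hh e
    simp only [Pi.add_apply, add_mul, Finset.sum_add_distrib, Pi.single_apply, ite_mul, zero_mul,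
      Finset.sum_ite_eq', Finset.mem_univ, if_true]
    linarith

theorem eq_zero_of_sum_boundary_eq_zero (C : (graph w).Coloring Bool)
    (h : Fin (w.length + 1) → ℤ) (hh : ∀ e, ∑ i, h i * boundary C i e = 0) : h = 0 := by
  funext i
  induction i using WellFoundedLT.induction with
  | _ i ih =>
    -- The lower side of tile `i` does not belong to a later tile.
    have hi := hh (side w i 0)
    rw [Finset.sum_eq_single i, boundary_side] at hi
    · rcases sideSign_eq C i 0 with hs | hs <;> simpa [hs] using hi
    · intro j _ hj
      rcases lt_or_gt_of_ne hj with hlt | hlt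
      · rw [ih j hlt, Pi.zero_apply, zero_mul]
      · rw [boundary_eq_zero, mul_zero]
        intro k hk
        have hmem : vertex w i 0 ∈ (side w j k : Sym2 (Vertex w)) :=
          hk ▸ mem_side.2 (Or.inl rfl)
        rcases mem_side.1 hmem with hv | hv <;> exact vertex_zero_ne hlt _ hv
    · simp

/-! ### Positive face twists -/

theorem mem_evenEdges_tileBoundary (C : (graph w).Coloring Bool) {i : Fin (w.length + 1)}
    {e : (graph w).edgeSet} :
    e ∈ FaceTwist.evenEdges C (tileBoundary w i) ↔ boundary C i e = 1 := by
  rw [boundary_eq_iff C one_ne_zero]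
  constructor
  · rintro ⟨_, ⟨k, rfl⟩, hk, he⟩
    exact ⟨k, Subtype.ext he.symm, if_pos hk⟩
  · rintro ⟨k, rfl, hk⟩
    refine ⟨_, ⟨k, rfl⟩, ?_, rfl⟩
    by_contra h
    exact absurd ((if_neg h).symm.trans hk) (by norm_num)

theorem mem_oddEdges_tileBoundary (C : (graph w).Coloring Bool) {i : Fin (w.length + 1)}
    {e : (graph w).edgeSet} :
    e ∈ FaceTwist.oddEdges C (tileBoundary w i) ↔ boundary C i e = -1 := by
  rw [boundary_eq_iff C (by norm_num)]
  constructor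
  · rintro ⟨_, ⟨k, rfl⟩, hk, he⟩
    exact ⟨k, Subtype.ext he.symm, if_neg (Bool.eq_false_iff.1 hk)⟩
  · rintro ⟨k, rfl, hk⟩
    refine ⟨_, ⟨k, rfl⟩, ?_, rfl⟩
    by_contra h
    exact absurd ((if_pos (Bool.not_eq_false _ ▸ h)).symm.trans hk) (by norm_num)

theorem isPositiveTwistAt_iff (C : (graph w).Coloring Bool) {n : Vertex w → ℕ}
    (i : Fin (w.length + 1)) (a b : Covers w n) :
    FaceTwist.IsPositiveTwistAt C (tileBoundary w i) a b ↔
      ∀ e, (b.mult e : ℤ) = a.mult e + boundary C i e := by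
  simp only [FaceTwist.IsPositiveTwistAt, mem_evenEdges_tileBoundary, mem_oddEdges_tileBoundary]
  constructor
  · rintro ⟨hodd, heven, hrest⟩ e
    rcases boundary_trichotomy C i e with h | h | h
    · rw [hrest e (by omega) (by omega), h, add_zero]
    · rw [heven e h, h]
      push_cast
      rfl
    · have := hodd e h
      omega
  · intro H
    refine ⟨fun e he => ?_, fun e he => ?_, fun e h1 h2 => ?_⟩
    · have := H e
      omega
    · have := H e
      omega
    · have := H e
      have := boundary_trichotomy C i e
      omega

end Snake

theorem theorem6 (w : List SnakeStep) (C : (Snake.graph w).Coloring Bool)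
    (n : Snake.Vertex w → ℕ) :
    ∃ _ : DistribLattice (Snake.Covers w n),
      (∀ a b : Snake.Covers w n, a ≤ b ↔ Snake.FaceTwistLE C a b) ∧
      (∀ a b : Snake.Covers w n, a ⋖ b ↔ Snake.PositiveFaceTwist C a b) := by
  obtain ⟨rank, h_rank⟩ := Snake.exists_rank C
  refine MixedDimerCover.exists_distribLattice (Snake.boundary C) (Snake.tileOfSign C 1)
    (Snake.tileOfSign C (-1)) rank ?_ ?_ (Snake.sum_boundary C) (Snake.exists_eq_sum_boundary C)
    (Snake.eq_zero_of_sum_boundary_eq_zero C) (Snake.PositiveFaceTwist C)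
    fun a b => exists_congr fun i => Snake.isPositiveTwistAt_iff C i a b
  · intro i e
    simp only [Snake.tileOfSign_eq_some_iff C one_ne_zero,
      Snake.tileOfSign_eq_some_iff C (neg_ne_zero.2 one_ne_zero)]
    rcases Snake.boundary_trichotomy C i e with h | h | h <;> simp [h]
  · intro e i j hi hj
    exact h_rank e i j ((Snake.tileOfSign_eq_some_iff C (by norm_num)).1 hi)
      ((Snake.tileOfSign_eq_some_iff C one_ne_zero).1 hj)
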